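/- Let $\mathbb{T}=\mathbb{R}/2\pi\mathbb{Z}$, let $\alpha>0$, and let $g:\mathbb{T}\to[0,\infty)$ be a smooth function with $\int_0^{2\pi}g(x)\,dx=1$ such that $\{x\in\mathbb{T}: g(x)>0\}$ is an open interval of $\mathbb{T}$. On the space $L^2(\mathbb{T})$ of complex-valued square-integrable functions (with respect to Lebesgue measure $dx$ of total mass $2\pi$), let $G$ be the bounded operator $$G\varphi(x)=g(x)\Big[\varphi(x)-\int_0^{2\pi}g(y)\varphi(y)\,dy\Big],$$ and write $\widehat{\varphi}(k)=\frac1{2\pi}\int_0^{2\pi}\varphi(x)e^{-ikx}\,dx$ for $k\in\mathbb{Z}$. For $t\in\mathbb{R}$ let $U(t)=e^{(\alpha\mathcal{H}\partial_x^2+\partial_x^3)t}$ ($\mathcal{H}$ the Hilbert transform) be the unitary operator on $L^2(\mathbb{T})$ given by $$\widehat{U(t)\varphi}(k)=e^{ik^2[\alpha\,\mathrm{sgn}(k)-k]t}\,\widehat{\varphi}(k),\qquad k\in\mathbb{Z},$$ and, for $\mu\in\mathbb{R}$, let $U_\mu(t)=e^{(\alpha\mathcal{H}\partial_x^2+\partial_x^3-2\mu\partial_x)t}$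 be the unitary operator given by $$\widehat{U_\mu(t)\varphi}(k)=e^{i(-k^3-2\mu k+\alpha k|k|)t}\,\widehat{\varphi}(k),\qquad k\in\mathbb{Z}.$$ Let $T>0$. Then: (1) There exists $\delta>0$ such that $$\int_0^T\|G\,U(-\tau)\varphi\|_{L^2(\mathbb{T})}^2\,d\tau\ \ge\ \delta^2\|\varphi\|_{L^2(\mathbb{T})}^2$$ for all $\varphi\in L^2(\mathbb{T})$ with mean zero, i.e. $\int_0^{2\pi}\varphi(x)\,dx=0$. (2) For every $\mu\in\mathbb{R}$ there exists $\delta>0$ such that $$\int_0^T\|G^{*}\,U_\mu(\tau)^{*}\varphi\|_{L^2(\mathbb{T})}^2\,d\tau\ \ge\ \delta^2\|\varphi\|_{L^2(\mathbb{T})}^2$$ for all $\varphi\in L^2(\mathbb{T})$ with mean zero, where $^{*}$ denotes the adjoint in $L^2(\mathbb{T})$. -/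

import Mathlib

open MeasureTheory
open scoped Real ContDiff

noncomputable section

namespace Benjamin

instance instFactTwoPiPos : Fact (0 < 2 * π) := ⟨Real.two_pi_pos⟩

/-- The torus `ℝ / 2πℤ`. Its `volume` is Lebesgue measure, of total mass `2π`. -/
abbrev Torus : Type := AddCircle (2 * π)

/-- Complex-valued `L²` of the torus, for Lebesgue measure of total mass `2π`. -/
abbrev L2 : Type := Lp ℂ 2 (volume : Measure Torus)

/-- The functions `ψ_k(x) = e^{ikx} / √(2π)`, as elements of `L²`. -/
def mode (k : ℤ) : L2 :=
  ContinuousMap.toLp (E := ℂ) 2 (volume : Measure Torus) ℂ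
    (((Real.sqrt (2 * π))⁻¹ : ℂ) • fourier k)

theorem integral_fourier_torus (n : ℤ) :
    ∫ x : Torus, fourier n x = if n = 0 then (2 * π : ℂ) else 0 := by
  split_ifs with h
  · subst h
    simp [measureReal_def, Real.pi_pos.le]
  · exact integral_eq_zero_of_add_right_eq_neg (μ := (volume : Measure Torus))
      (fourier_add_half_inv_index h Real.two_pi_pos)

theorem orthonormal_mode : Orthonormal ℂ mode := by
  have hs : ((Real.sqrt (2 * π) : ℝ) : ℂ) * (Real.sqrt (2 * π) : ℝ) = 2 * π := by
    rw [← Complex.ofReal_mul, Real.mul_self_sqrt Real.two_pi_pos.le]; push_cast; rfl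
  have hpi : (2 * π : ℂ) ≠ 0 := by exact_mod_cast Real.two_pi_pos.ne'
  have hs0 : ((Real.sqrt (2 * π) : ℝ) : ℂ) ≠ 0 := by
    intro h; rw [h, zero_mul] at hs; exact hpi hs.symm
  rw [orthonormal_iff_ite]
  intro i j
  have key := integral_fourier_torus (j + -i)
  simp only [mode, map_smul, inner_smul_left, inner_smul_right, map_inv₀, Complex.conj_ofReal]
  rw [ContinuousMap.inner_toLp (volume : Measure Torus) (fourier i) (fourier j)]
  simp_rw [← fourier_neg, ← fourier_add]
  rw [key]
  by_cases h : i = j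
  · subst h
    simp only [add_neg_cancel, if_true]
    rw [← hs]
    field_simp
  · have hij : j + -i ≠ 0 := fun h' => h (by omega)
    simp [h, hij]

theorem span_mode_closure_eq_top :
    (Submodule.span ℂ (Set.range mode)).topologicalClosure = ⊤ := by
  have h1 : (Submodule.span ℂ (Set.range fun k : ℤ =>
      ContinuousMap.toLp (E := ℂ) 2 (volume : Measure Torus) ℂ (fourier k))).topologicalClosure
      = ⊤ := by
    convert!
      (ContinuousMap.toLp_denseRange ℂ (volume : Measure Torus) ℂ
        ENNReal.ofNat_ne_top).topologicalClosure_map_submodule span_fourier_closure_eq_top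
    rw [Submodule.map_span, Set.range_comp']
    simp only [ContinuousLinearMap.coe_coe]
  rw [eq_top_iff, ← h1]
  apply Submodule.topologicalClosure_mono
  rw [Submodule.span_le]
  rintro _ ⟨k, rfl⟩
  have hs : ((Real.sqrt (2 * π) : ℝ) : ℂ) ≠ 0 := by
    exact_mod_cast (Real.sqrt_pos.2 Real.two_pi_pos).ne'
  have : ContinuousMap.toLp (E := ℂ) 2 (volume : Measure Torus) ℂ (fourier k)
      = ((Real.sqrt (2 * π) : ℝ) : ℂ) • mode k := by
    rw [mode, map_smul, smul_smul, mul_inv_cancel₀ hs, one_smul]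
  simp only [SetLike.mem_coe]
  rw [this]
  exact Submodule.smul_mem _ _ (Submodule.subset_span ⟨k, rfl⟩)

/-- `(ψ_k)` as a Hilbert basis of `L²`. -/
def modeBasis : HilbertBasis ℤ ℂ L2 :=
  HilbertBasis.mk orthonormal_mode span_mode_closure_eq_top.ge

theorem coe_modeBasis : ⇑modeBasis = mode := HilbertBasis.coe_mk _ _

/-- The coordinates in the basis `ψ_k` are `√(2π)` times the Fourier coefficients
`(2π)⁻¹ ∫ φ(x) e^{-ikx} dx`. -/
theorem modeBasis_repr (φ : L2) (k : ℤ) :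
    modeBasis.repr φ k = (Real.sqrt (2 * π) : ℂ) * fourierCoeff φ k := by
  have hs : ((Real.sqrt (2 * π) : ℝ) : ℂ) * (Real.sqrt (2 * π) : ℝ) = 2 * π := by
    rw [← Complex.ofReal_mul, Real.mul_self_sqrt Real.two_pi_pos.le]; push_cast; rfl
  have hpi : (2 * π : ℂ) ≠ 0 := by exact_mod_cast Real.two_pi_pos.ne'
  have hs0 : ((Real.sqrt (2 * π) : ℝ) : ℂ) ≠ 0 := by
    intro h; rw [h, zero_mul] at hs; exact hpi hs.symm
  rw [HilbertBasis.repr_apply_apply, coe_modeBasis, mode, map_smul, inner_smul_left,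
    L2.inner_def, fourierCoeff, AddCircle.integral_haarAddCircle]
  have : ∫ x : Torus, inner ℂ
      ((ContinuousMap.toLp (E := ℂ) 2 (volume : Measure Torus) ℂ (fourier k)) x) (φ x)
      = ∫ x : Torus, fourier (-k) x • φ x := by
    apply integral_congr_ae
    filter_upwards [ContinuousMap.coeFn_toLp (p := 2) (𝕜 := ℂ) (volume : Measure Torus)
      (fourier k)] with x hx
    rw [hx, RCLike.inner_apply, fourier_neg, smul_eq_mul, mul_comm]
  rw [this, Complex.real_smul, map_inv₀, Complex.conj_ofReal]
  push_cast
  rw [← mul_assoc, ← hs]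
  congr 1
  field_simp

theorem norm_phase (a : ℝ) : ‖Complex.exp (Complex.I * a)‖ = 1 := by
  rw [mul_comm]; exact Complex.norm_exp_ofReal_mul_I a

/-- The diagonal map `(c_k) ↦ (e^{i a_k} c_k)` on `ℓ²(ℤ)`, for real `a_k`. -/
def phase (a : ℤ → ℝ) (c : lp (fun _ : ℤ => ℂ) 2) : lp (fun _ : ℤ => ℂ) 2 :=
  ⟨fun k => Complex.exp (Complex.I * a k) * c k,
    (lp.memℓp c).mono' fun k => by rw [norm_mul, norm_phase, one_mul]⟩

theorem phase_apply (a : ℤ → ℝ) (c : lp (fun _ : ℤ => ℂ) 2) (k : ℤ) :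
    phase a c k = Complex.exp (Complex.I * a k) * c k := rfl

theorem phase_phase_neg (a b : ℤ → ℝ) (h : ∀ k, a k + b k = 0)
    (c : lp (fun _ : ℤ => ℂ) 2) : phase a (phase b c) = c := by
  ext k
  rw [phase_apply, phase_apply, ← mul_assoc, ← Complex.exp_add, ← mul_add,
    ← Complex.ofReal_add, h k]
  simp

/-- The diagonal map `phase a` as a unitary operator of `ℓ²(ℤ)`. -/
def phaseEquiv (a : ℤ → ℝ) :
    lp (fun _ : ℤ => ℂ) 2 ≃ₗᵢ[ℂ] lp (fun _ : ℤ => ℂ) 2 where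
  toFun := phase a
  invFun := phase fun k => -a k
  map_add' c d := by
    ext k; simp only [phase_apply, lp.coeFn_add, Pi.add_apply, mul_add]
  map_smul' z c := by
    ext k
    simp only [phase_apply, lp.coeFn_smul, Pi.smul_apply, smul_eq_mul, RingHom.id_apply]
    ring
  left_inv c := phase_phase_neg _ _ (fun k => by ring) c
  right_inv c := phase_phase_neg _ _ (fun k => by ring) c
  norm_map' c := by
    have h2 : 0 < (2 : ENNReal).toReal := by norm_num
    rw [lp.norm_eq_tsum_rpow h2, lp.norm_eq_tsum_rpow h2]
    congr 1
    apply tsum_congr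
    intro k
    change ‖phase a c k‖ ^ _ = _
    rw [phase_apply, norm_mul, norm_phase, one_mul]

/-- The operator of `L²` which multiplies the `k`-th Fourier coefficient by
`e^{i a_k t}`. -/
def unitaryGroup (a : ℤ → ℝ) (t : ℝ) : L2 →L[ℂ] L2 :=
  ((modeBasis.repr.trans (phaseEquiv fun k => a k * t)).trans
    modeBasis.repr.symm).toContinuousLinearEquiv.toContinuousLinearMap

theorem fourierCoeff_unitaryGroup (a : ℤ → ℝ) (t : ℝ) (φ : L2) (k : ℤ) :
    fourierCoeff (unitaryGroup a t φ) k
      = Complex.exp (Complex.I * a k * t) * fourierCoeff φ k := by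
  have hs : ((Real.sqrt (2 * π) : ℝ) : ℂ) ≠ 0 := by
    exact_mod_cast (Real.sqrt_pos.2 Real.two_pi_pos).ne'
  apply mul_left_cancel₀ hs
  rw [← modeBasis_repr, mul_left_comm, ← modeBasis_repr]
  have : modeBasis.repr (unitaryGroup a t φ)
      = phase (fun k => a k * t) (modeBasis.repr φ) :=
    modeBasis.repr.apply_symm_apply _
  rw [this, phase_apply]
  push_cast
  rw [mul_assoc]

/-- The group `U(t) = e^{(α H ∂ₓ² + ∂ₓ³) t}`:
`U(t)φ` has the Fourier coefficients `e^{i k² (α sgn k - k) t} φ̂(k)`. -/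
def U (α t : ℝ) : L2 →L[ℂ] L2 :=
  unitaryGroup (fun k => (k : ℝ) ^ 2 * (α * (k.sign : ℝ) - k)) t

/-- The group `U_μ(t) = e^{(α H ∂ₓ² + ∂ₓ³ - 2 μ ∂ₓ) t}`:
`U_μ(t)φ` has the Fourier coefficients `e^{i (-k³ - 2 μ k + α k |k|) t} φ̂(k)`. -/
def Umu (α μ t : ℝ) : L2 →L[ℂ] L2 :=
  unitaryGroup (fun k => -(k : ℝ) ^ 3 - 2 * μ * k + α * k * |(k : ℝ)|) t

/-- The assumptions on the localizing function `g` on the torus. -/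
structure IsControlProfile (g : C(Torus, ℝ)) : Prop where
  smooth : ContDiff ℝ ∞ fun x : ℝ => g (x : Torus)
  nonneg : ∀ x, 0 ≤ g x
  integral_eq_one : ∫ x : Torus, g x = 1
  /-- The set `{g > 0}` is an open arc (possibly the whole circle). -/
  arc : ∃ a b : ℝ, a < b ∧ {x : Torus | 0 < g x} = (fun x : ℝ => (x : Torus)) '' Set.Ioo a b

/-- A real continuous function, seen as a complex-valued one. -/
def toComplex (g : C(Torus, ℝ)) : C(Torus, ℂ) :=
  ⟨fun x => (g x : ℂ), Complex.continuous_ofReal.comp g.continuous⟩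

/-- Multiplication by `g` on `L²`. -/
def mulOp (g : C(Torus, ℝ)) : L2 →L[ℂ] L2 :=
  (ContinuousLinearMap.mul ℂ ℂ).holderL (volume : Measure Torus) ⊤ 2 2
    (ContinuousMap.toLp (E := ℂ) ⊤ (volume : Measure Torus) ℂ (toComplex g))

/-- The control operator `G h = g (h - ∫ g(y) h(y) dy)`. -/
def G (g : C(Torus, ℝ)) : L2 →L[ℂ] L2 :=
  mulOp g ∘L (ContinuousLinearMap.id ℂ L2 -
    (innerSL ℂ (ContinuousMap.toLp (E := ℂ) 2 (volume : Measure Torus) ℂ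
      (toComplex g))).smulRight
      (ContinuousMap.toLp (E := ℂ) 2 (volume : Measure Torus) ℂ 1))

theorem coeFn_G (g : C(Torus, ℝ)) (h : L2) :
    G g h =ᵐ[volume] fun x => (g x : ℂ) * (h x - ∫ y : Torus, (g y : ℂ) * h y) := by
  have hint : inner ℂ (ContinuousMap.toLp (E := ℂ) 2 (volume : Measure Torus) ℂ
      (toComplex g)) h = ∫ y : Torus, (g y : ℂ) * h y := by
    rw [L2.inner_def]
    apply integral_congr_ae
    filter_upwards [ContinuousMap.coeFn_toLp (p := 2) (𝕜 := ℂ) (volume : Measure Torus)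
      (toComplex g)] with x hx
    rw [hx, RCLike.inner_apply]
    simp [toComplex, mul_comm]
  set c : ℂ := ∫ y : Torus, (g y : ℂ) * h y
  have hG : G g h = mulOp g (h - c • ContinuousMap.toLp (E := ℂ) 2
      (volume : Measure Torus) ℂ 1) := by
    simp only [G, ContinuousLinearMap.comp_apply, sub_apply,
      ContinuousLinearMap.smulRight_apply, innerSL_apply_apply, hint,
      ContinuousLinearMap.id_apply]
  rw [hG]
  have hM := ContinuousLinearMap.coeFn_holder (r := 2) (ContinuousLinearMap.mul ℂ ℂ)
    (ContinuousMap.toLp (E := ℂ) ⊤ (volume : Measure Torus) ℂ (toComplex g))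
    (h - c • ContinuousMap.toLp (E := ℂ) 2 (volume : Measure Torus) ℂ 1)
  filter_upwards [hM, ContinuousMap.coeFn_toLp (p := ⊤) (𝕜 := ℂ) (volume : Measure Torus)
      (toComplex g), ContinuousMap.coeFn_toLp (p := 2) (𝕜 := ℂ) (volume : Measure Torus)
      (1 : C(Torus, ℂ)), Lp.coeFn_sub h (c • ContinuousMap.toLp (E := ℂ) 2
      (volume : Measure Torus) ℂ 1), Lp.coeFn_smul c (ContinuousMap.toLp (E := ℂ) 2
      (volume : Measure Torus) ℂ (1 : C(Torus, ℂ)))] with x h1 h2 h3 h4 h5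
  change ((ContinuousLinearMap.mul ℂ ℂ).holder 2 _ _ : L2) x = _
  rw [h1, h2, h4, Pi.sub_apply, h5, Pi.smul_apply, h3]
  simp [toComplex]

end Benjamin

end

noncomputable section

namespace Benjamin

open Filter Topology InnerProductSpace

/-! Both parts are one observability estimate: `G` is self-adjoint, the adjoint of a unitary group
is the group at time `-t`, and `U` has the symbol of `Umu` with `μ = 0`. The cubic term of the
symbol makes the gap quotients `|b k - b l| / |k - l|` tend to infinity (`spectralGap_dispersion`),
so no lower bound on `T` is needed.

High frequencies: expanding the observed energy gives a quadratic form in the Fourier coefficients.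
Its diagonal is bounded below because `‖G (mode k)‖` stays away from zero (`G_mode_bounded_below`);
its off-diagonal part is made small by a large gap (`ingham_weighted`). Hence `high_frequency`,
which leaves out finitely many modes.

Low frequencies: a compactness-uniqueness argument (`observability`). A failing sequence converges
strongly, since its low modes live in finite dimension and `high_frequency` controls the rest; its
limit is an unobserved unit vector of mean zero. Such a state vanishes (`eq_zero_of_unobserved`):
time differences remove chosen frequencies, which reduces it to trigonometric polynomials
annihilated by `G`. These are constant on an arc, hence constant by analyticity, hence zero without
a zero mode (`G_injective_trigonometric`). -/

/-! ### Diagonal unitary groups in the basis of modes. -/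

theorem repr_unitaryGroup (a : ℤ → ℝ) (t : ℝ) (φ : L2) (k : ℤ) :
    modeBasis.repr (unitaryGroup a t φ) k
      = Complex.exp (Complex.I * a k * t) * modeBasis.repr φ k := by
  rw [modeBasis_repr, modeBasis_repr, fourierCoeff_unitaryGroup]
  ring

theorem L2_ext {φ ψ : L2} (h : ∀ k, modeBasis.repr φ k = modeBasis.repr ψ k) : φ = ψ :=
  modeBasis.repr.injective (lp.ext (funext h))

theorem repr_mode (k l : ℤ) : modeBasis.repr (mode k) l = if l = k then 1 else 0 := by
  rw [HilbertBasis.repr_apply_apply, coe_modeBasis, orthonormal_iff_ite.1 orthonormal_mode]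

theorem repr_sum_mode (s : Finset ℤ) (c : ℤ → ℂ) (l : ℤ) :
    modeBasis.repr (∑ k ∈ s, c k • mode k) l = if l ∈ s then c l else 0 := by
  rw [HilbertBasis.repr_apply_apply, coe_modeBasis, inner_sum]
  simp [inner_smul_right, orthonormal_iff_ite.1 orthonormal_mode]

theorem unitaryGroup_mode (a : ℤ → ℝ) (t : ℝ) (k : ℤ) :
    unitaryGroup a t (mode k) = Complex.exp (Complex.I * a k * t) • mode k := by
  apply L2_ext
  intro l
  rw [repr_unitaryGroup, map_smul, lp.coeFn_smul, Pi.smul_apply, repr_mode]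
  split_ifs with h
  · rw [h, smul_eq_mul]
  · simp

theorem norm_unitaryGroup (a : ℤ → ℝ) (t : ℝ) (φ : L2) : ‖unitaryGroup a t φ‖ = ‖φ‖ :=
  ((modeBasis.repr.trans (phaseEquiv fun k => a k * t)).trans modeBasis.repr.symm).norm_map φ

theorem unitaryGroup_unitaryGroup (a : ℤ → ℝ) (s t : ℝ) (φ : L2) :
    unitaryGroup a s (unitaryGroup a t φ) = unitaryGroup a (s + t) φ := by
  apply L2_ext
  intro k
  simp only [repr_unitaryGroup]
  rw [← mul_assoc, ← Complex.exp_add]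
  push_cast
  ring_nf

theorem unitaryGroup_zero (a : ℤ → ℝ) (φ : L2) : unitaryGroup a 0 φ = φ := by
  apply L2_ext
  intro k
  simp [repr_unitaryGroup]

theorem unitaryGroup_neg (a : ℤ → ℝ) (t : ℝ) :
    unitaryGroup a (-t) = unitaryGroup (fun k => -a k) t := by
  ext1 φ
  apply L2_ext
  intro k
  simp [repr_unitaryGroup]

theorem adjoint_unitaryGroup (a : ℤ → ℝ) (t : ℝ) :
    ContinuousLinearMap.adjoint (unitaryGroup a t) = unitaryGroup a (-t) := by
  symm
  rw [ContinuousLinearMap.eq_adjoint_iff]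
  intro φ ψ
  have h : φ = unitaryGroup a t (unitaryGroup a (-t) φ) := by
    rw [unitaryGroup_unitaryGroup, add_neg_cancel, unitaryGroup_zero]
  conv_rhs => rw [h]
  exact (((modeBasis.repr.trans (phaseEquiv fun k => a k * t)).trans
    modeBasis.repr.symm).inner_map_map _ _).symm

/-- The states with a continuous orbit form a subspace containing every mode. It is closed because
the group is isometric, so orbits of a convergent sequence converge uniformly in time. -/
theorem continuous_unitaryGroup (a : ℤ → ℝ) (φ : L2) :
    Continuous fun t => unitaryGroup a t φ := by
  let V : Submodule ℂ L2 :=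
    { carrier := {φ | Continuous fun t => unitaryGroup a t φ}
      add_mem' := fun {x y} hx hy => by
        simp only [Set.mem_ofPred_eq, map_add] at *
        exact hx.add hy
      zero_mem' := by simp only [Set.mem_ofPred_eq, map_zero]; exact continuous_const
      smul_mem' := fun c x hx => by
        simp only [Set.mem_ofPred_eq, map_smul] at *
        exact hx.const_smul c }
  have hV : IsClosed (V : Set L2) := by
    rw [← isSeqClosed_iff_isClosed]
    intro u φ hu hφ
    change Continuous _
    refine TendstoUniformly.continuous (p := Filter.atTop)
      (F := fun n t => unitaryGroup a t (u n)) ?_ (Filter.Frequently.of_forall hu)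
    rw [Metric.tendstoUniformly_iff]
    intro ε hε
    filter_upwards [Metric.tendsto_atTop'.1 hφ ε hε |>.elim fun N hN =>
      Filter.eventually_gt_atTop N |>.mono hN] with n hn t
    rw [dist_eq_norm, ← map_sub, norm_unitaryGroup, ← dist_eq_norm, dist_comm]
    exact hn
  have hle : (Submodule.span ℂ (Set.range mode)).topologicalClosure ≤ V := by
    refine Submodule.topologicalClosure_minimal _ (Submodule.span_le.2 ?_) hV
    rintro _ ⟨k, rfl⟩
    change Continuous _
    simp only [unitaryGroup_mode]
    fun_prop
  rw [span_mode_closure_eq_top] at hle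
  exact hle Submodule.mem_top

/-! ### The control operator as a self-adjoint operator. -/

theorem inner_toLp_toComplex (g : C(Torus, ℝ)) (h : L2) :
    ⟪ContinuousMap.toLp (E := ℂ) 2 (volume : Measure Torus) ℂ (toComplex g), h⟫_ℂ
      = ∫ y : Torus, (g y : ℂ) * h y := by
  rw [L2.inner_def]
  apply integral_congr_ae
  filter_upwards [ContinuousMap.coeFn_toLp (p := 2) (𝕜 := ℂ) (volume : Measure Torus)
    (toComplex g)] with x hx
  rw [hx, RCLike.inner_apply]
  simp [toComplex, mul_comm]

theorem coeFn_mulOp (g : C(Torus, ℝ)) (h : L2) :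
    mulOp g h =ᵐ[volume] fun x => (g x : ℂ) * h x := by
  have hM := ContinuousLinearMap.coeFn_holder (r := 2) (ContinuousLinearMap.mul ℂ ℂ)
    (ContinuousMap.toLp (E := ℂ) ⊤ (volume : Measure Torus) ℂ (toComplex g)) h
  filter_upwards [hM, ContinuousMap.coeFn_toLp (p := ⊤) (𝕜 := ℂ) (volume : Measure Torus)
      (toComplex g)] with x h1 h2
  change ((ContinuousLinearMap.mul ℂ ℂ).holder 2 _ _ : L2) x = _
  rw [h1, h2]
  simp [toComplex]

/-- Multiplication minus a rank-one term `⟪γ, h⟫ γ`: this form makes the self-adjointness visible.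
-/
theorem G_eq (g : C(Torus, ℝ)) (h : L2) :
    G g h = mulOp g h
      - ⟪ContinuousMap.toLp (E := ℂ) 2 (volume : Measure Torus) ℂ (toComplex g), h⟫_ℂ •
        ContinuousMap.toLp (E := ℂ) 2 (volume : Measure Torus) ℂ (toComplex g) := by
  set γ := ContinuousMap.toLp (E := ℂ) 2 (volume : Measure Torus) ℂ (toComplex g)
  apply Lp.ext
  filter_upwards [coeFn_G g h, coeFn_mulOp g h, Lp.coeFn_sub (mulOp g h) (⟪γ, h⟫_ℂ • γ),
    Lp.coeFn_smul ⟪γ, h⟫_ℂ γ, ContinuousMap.coeFn_toLp (p := 2) (𝕜 := ℂ)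
    (volume : Measure Torus) (toComplex g)] with x h1 h2 h3 h4 h5
  rw [h1, h3, Pi.sub_apply, h2, h4, Pi.smul_apply, h5, inner_toLp_toComplex]
  simp only [toComplex, ContinuousMap.coe_mk, smul_eq_mul]
  ring

theorem inner_mulOp (g : C(Torus, ℝ)) (φ ψ : L2) : ⟪mulOp g φ, ψ⟫_ℂ = ⟪φ, mulOp g ψ⟫_ℂ := by
  rw [L2.inner_def, L2.inner_def]
  apply integral_congr_ae
  filter_upwards [coeFn_mulOp g φ, coeFn_mulOp g ψ] with x h1 h2
  rw [h1, h2, RCLike.inner_apply, RCLike.inner_apply]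
  simp only [map_mul, Complex.conj_ofReal]
  ring

theorem adjoint_G (g : C(Torus, ℝ)) : ContinuousLinearMap.adjoint (G g) = G g := by
  symm
  rw [ContinuousLinearMap.eq_adjoint_iff]
  intro φ ψ
  rw [G_eq, G_eq, inner_sub_left, inner_sub_right, inner_mulOp, inner_smul_left,
    inner_smul_right, inner_conj_symm]
  congr 1
  exact mul_comm _ _

/-! ### Ingham's inequality with vector coefficients. -/

section Ingham

/-- The Fourier integral of the weight `t (T - t)` on `[0, T]`. -/
def weightIntegral (T ξ : ℝ) : ℂ :=
  ∫ t in (0 : ℝ)..T, ((t * (T - t) : ℝ) : ℂ) * Complex.exp (Complex.I * ξ * t)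

theorem weightIntegral_zero (T : ℝ) : weightIntegral T 0 = ((T ^ 3 / 6 : ℝ) : ℂ) := by
  have h : ∫ t in (0 : ℝ)..T, t * (T - t) = T ^ 3 / 6 := by
    have : ∀ t : ℝ, t * (T - t) = T * t - t ^ 2 := fun t => by ring
    simp only [this]
    rw [intervalIntegral.integral_sub (by apply Continuous.intervalIntegrable; fun_prop)
      (by apply Continuous.intervalIntegrable; fun_prop),
      intervalIntegral.integral_const_mul, integral_id, integral_pow]
    norm_num
    ring
  rw [← h, ← intervalIntegral.integral_ofReal]
  simp [weightIntegral]

/-- The weight vanishes at both endpoints, so the boundary term of order `1 / ξ` disappears. The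
resulting quadratic decay is summable over integer differences, which is why this weight is used. -/
theorem norm_weightIntegral_le {T ξ : ℝ} (hT : 0 < T) (hξ : 1 ≤ |ξ|) :
    ‖weightIntegral T ξ‖ ≤ (2 * T + 4) / ξ ^ 2 := by
  have hξ0 : ξ ≠ 0 := by
    rintro rfl
    norm_num at hξ
  set z : ℂ := Complex.I * ξ with hz
  have hz0 : z ≠ 0 := mul_ne_zero Complex.I_ne_zero (by exact_mod_cast hξ0)
  have hnz : ‖z‖ = |ξ| := by simp [hz]
  -- Repeated integration by parts gives the antiderivative `exp (z t) (p / z - p' / z² + p'' / z³)`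
  -- with `p = t (T - t)`.
  let F : ℝ → ℂ := fun t => Complex.exp (z * t) *
    ((t : ℂ) * (T - t) / z - (T - 2 * t) / z ^ 2 - 2 / z ^ 3)
  have hF : ∀ t : ℝ, HasDerivAt F
      (((t * (T - t) : ℝ) : ℂ) * Complex.exp (Complex.I * ξ * t)) t := by
    intro t
    have hid : HasDerivAt (fun t : ℝ => (t : ℂ)) 1 t := Complex.ofRealCLM.hasDerivAt
    have h1 : HasDerivAt (fun t : ℝ => Complex.exp (z * t)) (Complex.exp (z * t) * (z * 1)) t :=
      (hid.const_mul z).cexp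
    have h2 := (((hid.mul (hid.const_sub (T : ℂ))).div_const z).sub
      (((hid.const_mul 2).const_sub (T : ℂ)).div_const (z ^ 2))).sub_const (2 / z ^ 3)
    refine (h1.mul h2).congr_deriv ?_
    rw [← hz]
    simp only [Pi.mul_apply, Pi.sub_apply]
    push_cast
    field_simp
    ring
  have hint : weightIntegral T ξ = F T - F 0 := by
    refine intervalIntegral.integral_eq_sub_of_hasDerivAt (fun t _ => hF t) ?_
    apply Continuous.intervalIntegrable
    fun_prop
  have hexp : ∀ t : ℝ, ‖Complex.exp (z * t)‖ = 1 := by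
    intro t
    rw [hz, mul_assoc, ← Complex.ofReal_mul, mul_comm]
    exact Complex.norm_exp_ofReal_mul_I _
  have hξ2 : 0 < |ξ| := by linarith
  have e3 : 2 / |ξ| ^ 3 ≤ 2 / |ξ| ^ 2 := by
    apply div_le_div_of_nonneg_left (by norm_num) (by positivity)
    exact pow_le_pow_right₀ hξ (by norm_num)
  have b1 : ‖F T‖ ≤ T / |ξ| ^ 2 + 2 / |ξ| ^ 2 := by
    have : F T = Complex.exp (z * T) * (T / z ^ 2 - 2 / z ^ 3) := by
      simp only [F]; ring
    rw [this, norm_mul, hexp, one_mul]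
    refine (norm_sub_le _ _).trans ?_
    simp only [norm_div, norm_pow, hnz, Complex.norm_real, Real.norm_eq_abs, abs_of_pos hT,
      Complex.norm_ofNat]
    linarith
  have b2 : ‖F 0‖ ≤ T / |ξ| ^ 2 + 2 / |ξ| ^ 2 := by
    have : F 0 = Complex.exp (z * (0 : ℝ)) * (-(T / z ^ 2) - 2 / z ^ 3) := by
      simp only [F]; push_cast; ring
    rw [this, norm_mul, hexp, one_mul]
    refine (norm_sub_le _ _).trans ?_
    simp only [norm_neg, norm_div, norm_pow, hnz, Complex.norm_real, Real.norm_eq_abs,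
      abs_of_pos hT, Complex.norm_ofNat]
    linarith
  rw [hint]
  refine (norm_sub_le _ _).trans ((add_le_add b1 b2).trans (le_of_eq ?_))
  rw [← sq_abs ξ]
  ring

/-- The term `l = k` is harmless: `1 / 0 = 0`. -/
theorem sum_inv_sq_sub_le (s : Finset ℤ) (k : ℤ) :
    ∑ l ∈ s, 1 / ((k - l : ℤ) : ℝ) ^ 2 ≤ ∑' j : ℤ, 1 / (j : ℝ) ^ 2 := by
  have hs : Summable fun j : ℤ => 1 / (j : ℝ) ^ 2 :=
    Real.summable_one_div_int_pow.2 (by norm_num)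
  have h1 := (Equiv.subLeft k).summable_iff.2 hs
  have h2 := (Equiv.subLeft k).tsum_eq fun j : ℤ => 1 / (j : ℝ) ^ 2
  rw [← h2]
  exact h1.sum_le_tsum s fun l _ => by positivity

/-- A Schur test for the kernel `1 / (k - l)²` off the diagonal. -/
theorem schur_inv_sq (s : Finset ℤ) (x : ℤ → ℝ) (hx : ∀ k, 0 ≤ x k) :
    ∑ k ∈ s, ∑ l ∈ s, 1 / ((k - l : ℤ) : ℝ) ^ 2 * ((x k + x l) / 2)
      ≤ (∑' j : ℤ, 1 / (j : ℝ) ^ 2) * ∑ k ∈ s, x k := by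
  have h1 : ∑ k ∈ s, ∑ l ∈ s, 1 / ((k - l : ℤ) : ℝ) ^ 2 * x k
      ≤ (∑' j : ℤ, 1 / (j : ℝ) ^ 2) * ∑ k ∈ s, x k := by
    rw [Finset.mul_sum]
    refine Finset.sum_le_sum fun k _ => ?_
    rw [← Finset.sum_mul]
    exact mul_le_mul_of_nonneg_right (sum_inv_sq_sub_le s k) (hx k)
  have h2 : ∑ k ∈ s, ∑ l ∈ s, 1 / ((k - l : ℤ) : ℝ) ^ 2 * x l
      = ∑ k ∈ s, ∑ l ∈ s, 1 / ((k - l : ℤ) : ℝ) ^ 2 * x k := by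
    rw [Finset.sum_comm]
    refine Finset.sum_congr rfl fun k _ => Finset.sum_congr rfl fun l _ => ?_
    push_cast
    ring
  have h3 : ∑ k ∈ s, ∑ l ∈ s, 1 / ((k - l : ℤ) : ℝ) ^ 2 * ((x k + x l) / 2)
      = (∑ k ∈ s, ∑ l ∈ s, 1 / ((k - l : ℤ) : ℝ) ^ 2 * x k
        + ∑ k ∈ s, ∑ l ∈ s, 1 / ((k - l : ℤ) : ℝ) ^ 2 * x l) / 2 := by
    rw [← Finset.sum_add_distrib, Finset.sum_div]
    refine Finset.sum_congr rfl fun k _ => ?_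
    rw [← Finset.sum_add_distrib, Finset.sum_div]
    exact Finset.sum_congr rfl fun l _ => by ring
  rw [h3, h2]
  linarith

variable {H : Type*} [NormedAddCommGroup H] [InnerProductSpace ℂ H]

theorem integral_weight_norm_sq (T : ℝ) (s : Finset ℤ) (b : ℤ → ℝ) (c : ℤ → ℂ) (v : ℤ → H) :
    ∫ t in (0 : ℝ)..T, t * (T - t) *
        ‖∑ k ∈ s, (c k * Complex.exp (Complex.I * b k * t)) • v k‖ ^ 2
      = ∑ k ∈ s, ∑ l ∈ s, (starRingEnd ℂ (c k) * c l * ⟪v k, v l⟫_ℂ *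
          weightIntegral T (b l - b k)).re := by
  have key : ((∫ t in (0 : ℝ)..T, t * (T - t) *
        ‖∑ k ∈ s, (c k * Complex.exp (Complex.I * b k * t)) • v k‖ ^ 2 : ℝ) : ℂ)
      = ∑ k ∈ s, ∑ l ∈ s, starRingEnd ℂ (c k) * c l * ⟪v k, v l⟫_ℂ *
          weightIntegral T (b l - b k) := by
    rw [← intervalIntegral.integral_ofReal]
    have hpt : ∀ t : ℝ, ((t * (T - t) *
        ‖∑ k ∈ s, (c k * Complex.exp (Complex.I * b k * t)) • v k‖ ^ 2 : ℝ) : ℂ)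
        = ∑ k ∈ s, ∑ l ∈ s, starRingEnd ℂ (c k) * c l * ⟪v k, v l⟫_ℂ *
          (((t * (T - t) : ℝ) : ℂ) * Complex.exp (Complex.I * (b l - b k : ℝ) * t)) := by
      intro t
      have hsq : ∀ x : H, ((‖x‖ : ℝ) : ℂ) ^ 2 = ⟪x, x⟫_ℂ :=
        fun x => (inner_self_eq_norm_sq_to_K x).symm
      rw [Complex.ofReal_mul, Complex.ofReal_pow, hsq, sum_inner, Finset.mul_sum]
      refine Finset.sum_congr rfl fun k _ => ?_
      rw [inner_sum, Finset.mul_sum]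
      refine Finset.sum_congr rfl fun l _ => ?_
      rw [inner_smul_left, inner_smul_right, map_mul, ← Complex.exp_conj]
      simp only [map_mul, Complex.conj_I, Complex.conj_ofReal]
      have : Complex.exp (Complex.I * (b l - b k : ℝ) * t)
          = Complex.exp (-Complex.I * b k * t) * Complex.exp (Complex.I * b l * t) := by
        rw [← Complex.exp_add]
        push_cast
        ring_nf
      rw [this]
      ring
    simp only [hpt]
    rw [intervalIntegral.integral_finsetSum]
    · refine Finset.sum_congr rfl fun k _ => ?_
      rw [intervalIntegral.integral_finsetSum]
      · refine Finset.sum_congr rfl fun l _ => ?_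
        rw [intervalIntegral.integral_const_mul]
        rfl
      · intro l _
        apply Continuous.intervalIntegrable
        fun_prop
    · intro k _
      apply Continuous.intervalIntegrable
      fun_prop
  have := congrArg Complex.re key
  rw [Complex.ofReal_re] at this
  rw [this]
  simp only [Complex.re_sum]

/-- Ingham's inequality for vector coefficients, with the weight `t (T - t)`. -/
theorem ingham_weighted {T : ℝ} (hT : 0 < T) (s : Finset ℤ) (b : ℤ → ℝ) (c : ℤ → ℂ)
    (v : ℤ → H) {m B γ : ℝ} (hm : 0 ≤ m) (hB : ∀ k, ‖v k‖ ≤ B) (hmv : ∀ k ∈ s, m ≤ ‖v k‖)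
    (hγ : 1 ≤ γ) (hgap : ∀ k ∈ s, ∀ l ∈ s, γ * |((k - l : ℤ) : ℝ)| ≤ |b k - b l|) :
    (T ^ 3 / 6 * m ^ 2 - B ^ 2 * (2 * T + 4) / γ ^ 2 * ∑' j : ℤ, 1 / (j : ℝ) ^ 2) *
        ∑ k ∈ s, ‖c k‖ ^ 2
      ≤ ∫ t in (0 : ℝ)..T, t * (T - t) *
        ‖∑ k ∈ s, (c k * Complex.exp (Complex.I * b k * t)) • v k‖ ^ 2 := by
  have hB0 : 0 ≤ B := (norm_nonneg _).trans (hB 0)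
  rw [integral_weight_norm_sq]
  set D : ℝ := B ^ 2 * (2 * T + 4) / γ ^ 2 with hD
  have hD0 : 0 ≤ D := by positivity
  -- The subtracted term is zero on the diagonal by `1 / 0 = 0`, so one formula covers both the
  -- diagonal and the off-diagonal entries.
  have hterm : ∀ k ∈ s, ∀ l ∈ s,
      (if k = l then T ^ 3 / 6 * m ^ 2 * ‖c k‖ ^ 2 else 0)
        - D * (1 / ((k - l : ℤ) : ℝ) ^ 2 * ((‖c k‖ ^ 2 + ‖c l‖ ^ 2) / 2))
      ≤ (starRingEnd ℂ (c k) * c l * ⟪v k, v l⟫_ℂ * weightIntegral T (b l - b k)).re := by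
    intro k hk l hl
    by_cases h : k = l
    · subst h
      have hR : starRingEnd ℂ (c k) * c k * ⟪v k, v k⟫_ℂ * weightIntegral T (b k - b k)
          = ((‖c k‖ ^ 2 * ‖v k‖ ^ 2 * (T ^ 3 / 6) : ℝ) : ℂ) := by
        rw [sub_self, weightIntegral_zero, inner_self_eq_norm_sq_to_K, Complex.conj_mul']
        push_cast
        rfl
      rw [hR, Complex.ofReal_re]
      simp only [if_true, sub_self, Int.cast_zero]
      have h2 : m ^ 2 ≤ ‖v k‖ ^ 2 := pow_le_pow_left₀ hm (hmv k hk) 2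
      have h3 : 0 ≤ T ^ 3 / 6 * ‖c k‖ ^ 2 := by positivity
      nlinarith [mul_le_mul_of_nonneg_left h2 h3]
    · simp only [if_neg h, zero_sub]
      have hkl : (1 : ℝ) ≤ |((k - l : ℤ) : ℝ)| := by
        have : (1 : ℤ) ≤ |k - l| := Int.one_le_abs (sub_ne_zero.2 h)
        exact_mod_cast this
      have hg := hgap k hk l hl
      have hx : γ * |((k - l : ℤ) : ℝ)| ≤ |b l - b k| := by rwa [abs_sub_comm]
      have h1 : 1 ≤ |b l - b k| := by nlinarith
      have hW : ‖weightIntegral T (b l - b k)‖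
          ≤ (2 * T + 4) / (γ ^ 2 * ((k - l : ℤ) : ℝ) ^ 2) := by
        refine (norm_weightIntegral_le hT h1).trans ?_
        apply div_le_div_of_nonneg_left (by positivity)
        · have : 0 < ((k - l : ℤ) : ℝ) ^ 2 := by rw [← sq_abs]; positivity
          positivity
        · rw [← sq_abs ((k - l : ℤ) : ℝ), ← sq_abs (b l - b k), ← mul_pow]
          exact pow_le_pow_left₀ (by positivity) hx 2
      have hin : ‖⟪v k, v l⟫_ℂ‖ ≤ B ^ 2 := by
        refine (norm_inner_le_norm _ _).trans ?_
        rw [sq]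
        exact mul_le_mul (hB k) (hB l) (norm_nonneg _) hB0
      have hn : ‖starRingEnd ℂ (c k) * c l * ⟪v k, v l⟫_ℂ * weightIntegral T (b l - b k)‖
          ≤ D * (1 / ((k - l : ℤ) : ℝ) ^ 2 * ((‖c k‖ ^ 2 + ‖c l‖ ^ 2) / 2)) := by
        rw [norm_mul, norm_mul, norm_mul, RCLike.norm_conj]
        have hc : ‖c k‖ * ‖c l‖ ≤ (‖c k‖ ^ 2 + ‖c l‖ ^ 2) / 2 := by
          nlinarith [sq_nonneg (‖c k‖ - ‖c l‖)]
        calc ‖c k‖ * ‖c l‖ * ‖⟪v k, v l⟫_ℂ‖ * ‖weightIntegral T (b l - b k)‖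
            ≤ (‖c k‖ ^ 2 + ‖c l‖ ^ 2) / 2 * B ^ 2
                * ((2 * T + 4) / (γ ^ 2 * ((k - l : ℤ) : ℝ) ^ 2)) := by gcongr
          _ = _ := by
            rw [hD]
            field_simp
      have := (abs_le.1 ((Complex.abs_re_le_norm _).trans hn)).1
      exact this
  calc _ = ∑ k ∈ s, ∑ l ∈ s, (if k = l then T ^ 3 / 6 * m ^ 2 * ‖c k‖ ^ 2 else 0)
        - D * ((∑' j : ℤ, 1 / (j : ℝ) ^ 2) * ∑ k ∈ s, ‖c k‖ ^ 2) := by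
        have : ∑ k ∈ s, ∑ l ∈ s, (if k = l then T ^ 3 / 6 * m ^ 2 * ‖c k‖ ^ 2 else 0)
            = T ^ 3 / 6 * m ^ 2 * ∑ k ∈ s, ‖c k‖ ^ 2 := by
          rw [Finset.mul_sum]
          refine Finset.sum_congr rfl fun k hk => ?_
          rw [Finset.sum_ite_eq, if_pos hk]
        rw [this]
        ring
    _ ≤ ∑ k ∈ s, ∑ l ∈ s, (if k = l then T ^ 3 / 6 * m ^ 2 * ‖c k‖ ^ 2 else 0)
        - D * ∑ k ∈ s, ∑ l ∈ s,
          1 / ((k - l : ℤ) : ℝ) ^ 2 * ((‖c k‖ ^ 2 + ‖c l‖ ^ 2) / 2) := by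
        have := mul_le_mul_of_nonneg_left
          (schur_inv_sq s (fun k => ‖c k‖ ^ 2) fun k => by positivity) hD0
        linarith
    _ = ∑ k ∈ s, ∑ l ∈ s, ((if k = l then T ^ 3 / 6 * m ^ 2 * ‖c k‖ ^ 2 else 0)
        - D * (1 / ((k - l : ℤ) : ℝ) ^ 2 * ((‖c k‖ ^ 2 + ‖c l‖ ^ 2) / 2))) := by
        simp only [Finset.mul_sum, Finset.sum_sub_distrib]
    _ ≤ _ := Finset.sum_le_sum fun k hk => Finset.sum_le_sum fun l hl => hterm k hk l hl

end Ingham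

/-! ### Abstract observability under a spectral gap. -/

section Observability

/-- The differences of the frequencies `b k` become arbitrarily large compared with those of the
indices, once one of the indices is large. -/
def SpectralGap (b : ℤ → ℝ) : Prop :=
  ∀ γ : ℝ, ∃ N : ℕ, ∀ k l : ℤ, (N : ℤ) ≤ |k| → γ * |((k - l : ℤ) : ℝ)| ≤ |b k - b l|

/-- The energy of the evolution of `φ` observed through `C` in the time interval `[0, T]`. -/
def energy (C : L2 →L[ℂ] L2) (b : ℤ → ℝ) (T : ℝ) (φ : L2) : ℝ :=
  ∫ t in (0 : ℝ)..T, ‖C (unitaryGroup b t φ)‖ ^ 2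

variable (C : L2 →L[ℂ] L2) (b : ℤ → ℝ)

theorem continuous_observation (φ : L2) : Continuous fun t => C (unitaryGroup b t φ) :=
  C.continuous.comp (continuous_unitaryGroup b φ)

theorem intervalIntegrable_observation (φ : L2) (s t : ℝ) :
    IntervalIntegrable (fun t => ‖C (unitaryGroup b t φ)‖ ^ 2) volume s t :=
  ((continuous_observation C b φ).norm.pow 2).intervalIntegrable _ _

theorem energy_nonneg {T : ℝ} (hT : 0 ≤ T) (φ : L2) : 0 ≤ energy C b T φ :=
  intervalIntegral.integral_nonneg hT fun _ _ => by positivity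

theorem energy_add_le {T : ℝ} (hT : 0 ≤ T) (φ ψ : L2) :
    energy C b T (φ + ψ) ≤ 2 * energy C b T φ + 2 * energy C b T ψ := by
  unfold energy
  rw [← intervalIntegral.integral_const_mul, ← intervalIntegral.integral_const_mul,
    ← intervalIntegral.integral_add ((intervalIntegrable_observation C b φ 0 T).const_mul 2)
      ((intervalIntegrable_observation C b ψ 0 T).const_mul 2)]
  refine intervalIntegral.integral_mono_on hT (intervalIntegrable_observation C b _ 0 T)
    (((intervalIntegrable_observation C b φ 0 T).const_mul 2).add
      ((intervalIntegrable_observation C b ψ 0 T).const_mul 2)) fun t _ => ?_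
  rw [map_add, map_add]
  have := norm_add_le (C (unitaryGroup b t φ)) (C (unitaryGroup b t ψ))
  have h0 := norm_nonneg (C (unitaryGroup b t φ) + C (unitaryGroup b t ψ))
  nlinarith [sq_nonneg (‖C (unitaryGroup b t φ)‖ - ‖C (unitaryGroup b t ψ)‖)]

theorem energy_le {T : ℝ} (hT : 0 ≤ T) (φ : L2) :
    energy C b T φ ≤ T * ‖C‖ ^ 2 * ‖φ‖ ^ 2 := by
  have h : energy C b T φ ≤ ∫ _t in (0 : ℝ)..T, ‖C‖ ^ 2 * ‖φ‖ ^ 2 := by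
    refine intervalIntegral.integral_mono_on hT (intervalIntegrable_observation C b _ 0 T)
      intervalIntegrable_const fun t _ => ?_
    rw [← mul_pow, ← norm_unitaryGroup b t φ]
    exact pow_le_pow_left₀ (norm_nonneg _) (C.le_opNorm _) 2
  rw [intervalIntegral.integral_const, sub_zero, smul_eq_mul, ← mul_assoc] at h
  exact h

theorem observation_eq_zero_of_energy {T : ℝ} (hT : 0 < T) {φ : L2} (h : energy C b T φ ≤ 0)
    {t : ℝ} (ht : t ∈ Set.Icc 0 T) : C (unitaryGroup b t φ) = 0 := by
  by_contra hne
  refine h.not_gt (intervalIntegral.integral_pos hT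
    ((continuous_observation C b φ).norm.pow 2).continuousOn (fun _ _ => by positivity)
    ⟨t, ht, by positivity⟩)

theorem norm_sq_sum_mode (s : Finset ℤ) (c : ℤ → ℂ) :
    ‖∑ k ∈ s, c k • mode k‖ ^ 2 = ∑ k ∈ s, ‖c k‖ ^ 2 := by
  have h := orthonormal_mode.inner_sum c c s
  rw [inner_self_eq_norm_sq_to_K] at h
  have h2 : ((‖∑ k ∈ s, c k • mode k‖ ^ 2 : ℝ) : ℂ) = ((∑ k ∈ s, ‖c k‖ ^ 2 : ℝ) : ℂ) := by
    push_cast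
    refine h.trans (Finset.sum_congr rfl fun k _ => ?_)
    rw [Complex.conj_mul']
  exact_mod_cast h2

theorem high_frequency_finite {T : ℝ} (hT : 0 < T) {m γ : ℝ} (hm : 0 ≤ m) (hγ : 1 ≤ γ)
    (hγ2 : ‖C‖ ^ 2 * (2 * T + 4) / γ ^ 2 * (∑' j : ℤ, 1 / (j : ℝ) ^ 2) ≤ T ^ 3 / 12 * m ^ 2)
    (s : Finset ℤ) (hmC : ∀ k ∈ s, m ≤ ‖C (mode k)‖)
    (hgap : ∀ k ∈ s, ∀ l ∈ s, γ * |((k - l : ℤ) : ℝ)| ≤ |b k - b l|) (c : ℤ → ℂ) :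
    T * m ^ 2 / 3 * ‖∑ k ∈ s, c k • mode k‖ ^ 2 ≤ energy C b T (∑ k ∈ s, c k • mode k) := by
  have hobs : ∀ t : ℝ, C (unitaryGroup b t (∑ k ∈ s, c k • mode k))
      = ∑ k ∈ s, (c k * Complex.exp (Complex.I * b k * t)) • C (mode k) := by
    intro t
    rw [map_sum, map_sum]
    refine Finset.sum_congr rfl fun k _ => ?_
    rw [map_smul, unitaryGroup_mode, map_smul, map_smul, smul_smul]
  have hB : ∀ k, ‖C (mode k)‖ ≤ ‖C‖ := fun k => by
    simpa [orthonormal_mode.1 k] using C.le_opNorm (mode k)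
  have h1 := ingham_weighted hT s b c (fun k => C (mode k)) hm hB hmC hγ hgap
  simp only [← hobs] at h1
  rw [← norm_sq_sum_mode] at h1
  set φ := ∑ k ∈ s, c k • mode k
  have h2 : ∫ t in (0 : ℝ)..T, t * (T - t) * ‖C (unitaryGroup b t φ)‖ ^ 2
      ≤ T ^ 2 / 4 * energy C b T φ := by
    rw [energy, ← intervalIntegral.integral_const_mul]
    refine intervalIntegral.integral_mono_on hT.le ?_
      ((intervalIntegrable_observation C b φ 0 T).const_mul _) fun t _ => ?_
    · have := continuous_observation C b φ
      exact Continuous.intervalIntegrable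
        (.mul (by fun_prop) (this.norm.pow 2)) _ _
    -- The maximum of `t (T - t)` is `T² / 4`.
    · exact mul_le_mul_of_nonneg_right (by nlinarith [sq_nonneg (T - 2 * t)]) (by positivity)
  have h3 : T ^ 3 / 12 * m ^ 2 * ‖φ‖ ^ 2 ≤ T ^ 2 / 4 * energy C b T φ := by
    refine le_trans (mul_le_mul_of_nonneg_right ?_ (by positivity)) (h1.trans h2)
    linarith
  have h4 : 0 < T ^ 2 / 4 := by positivity
  refine le_of_mul_le_mul_left (le_of_eq_of_le ?_ h3) h4
  ring

/-- Observability of high frequencies. -/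
theorem high_frequency (hb : SpectralGap b) {m : ℝ} (hm : 0 < m)
    (hmC : ∀ᶠ k : ℤ in cofinite, m ≤ ‖C (mode k)‖) {T : ℝ} (hT : 0 < T) :
    ∃ N : ℕ, ∃ c > 0, (∀ k l : ℤ, (N : ℤ) ≤ |k| → b k = b l → k = l) ∧
      ∀ φ : L2, (∀ k : ℤ, |k| < N → modeBasis.repr φ k = 0) →
        c * ‖φ‖ ^ 2 ≤ energy C b T φ := by
  set D : ℝ := ‖C‖ ^ 2 * (2 * T + 4) * ∑' j : ℤ, 1 / (j : ℝ) ^ 2 with hD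
  -- Chosen so that the off-diagonal part is at most half of the diagonal `T³ / 6 * m²`; `γ ≥ 1`
  -- gives `γ ≤ γ²`.
  set γ : ℝ := max 1 (D / (T ^ 3 / 12 * m ^ 2)) with hγ
  have hγ1 : 1 ≤ γ := le_max_left _ _
  have hγ2 : ‖C‖ ^ 2 * (2 * T + 4) / γ ^ 2 * (∑' j : ℤ, 1 / (j : ℝ) ^ 2)
      ≤ T ^ 3 / 12 * m ^ 2 := by
    have h1 : D ≤ γ * (T ^ 3 / 12 * m ^ 2) :=
      (div_le_iff₀ (by positivity)).1 (le_max_right _ _)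
    have h2 : γ * (T ^ 3 / 12 * m ^ 2) ≤ γ ^ 2 * (T ^ 3 / 12 * m ^ 2) :=
      mul_le_mul_of_nonneg_right (by nlinarith) (by positivity)
    have h3 : ‖C‖ ^ 2 * (2 * T + 4) / γ ^ 2 * (∑' j : ℤ, 1 / (j : ℝ) ^ 2) = D / γ ^ 2 := by
      rw [hD]
      ring
    rw [h3, div_le_iff₀ (by positivity), mul_comm]
    exact h1.trans h2
  obtain ⟨N₁, hN₁⟩ := hb γ
  obtain ⟨N₂, hN₂⟩ : ∃ N₂ : ℕ, ∀ k : ℤ, (N₂ : ℤ) ≤ |k| → m ≤ ‖C (mode k)‖ := by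
    have hfin : {k : ℤ | ¬ m ≤ ‖C (mode k)‖}.Finite := hmC
    obtain ⟨M, hM⟩ := (hfin.image Int.natAbs).bddAbove
    refine ⟨M + 1, fun k hk => ?_⟩
    by_contra hne
    have : k.natAbs ≤ M := hM ⟨k, hne, rfl⟩
    rw [Int.abs_eq_natAbs] at hk
    omega
  refine ⟨max N₁ N₂, T * m ^ 2 / 3 / 2, by positivity, ?_, ?_⟩
  -- Only `k` is assumed large in the gap condition, so a high frequency coincides with no other
  -- frequency, high or low.
  · intro k l hk hkl
    by_contra hne
    have h1 := hN₁ k l (le_trans (by push_cast; exact le_max_left _ _) hk)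
    rw [hkl, sub_self, abs_zero] at h1
    have h2 : 0 < |((k - l : ℤ) : ℝ)| := by
      rw [abs_pos]
      exact_mod_cast sub_ne_zero.2 hne
    nlinarith
  · intro φ hφ
    have hsum := modeBasis.hasSum_repr φ
    rw [coe_modeBasis] at hsum
    have hfin : ∀ s : Finset ℤ, T * m ^ 2 / 3 * ‖∑ k ∈ s, modeBasis.repr φ k • mode k‖ ^ 2
        ≤ energy C b T (∑ k ∈ s, modeBasis.repr φ k • mode k) := by
      intro s
      have hs : ∑ k ∈ s, modeBasis.repr φ k • mode k
          = ∑ k ∈ s.filter fun k : ℤ => ((max N₁ N₂ : ℕ) : ℤ) ≤ |k|, modeBasis.repr φ k • mode k := by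
        symm
        apply Finset.sum_filter_of_ne
        intro k _ hk
        by_contra hlt
        exact hk (by rw [hφ k (not_le.1 hlt), zero_smul])
      rw [hs]
      refine high_frequency_finite C b hT hm.le hγ1 hγ2 _ (fun k hk => hN₂ k ?_)
        (fun k hk l _ => hN₁ k l ?_) _
      · exact le_trans (by push_cast; exact le_max_right _ _) (Finset.mem_filter.1 hk).2
      · exact le_trans (by push_cast; exact le_max_left _ _) (Finset.mem_filter.1 hk).2
    -- Passing to the limit through `energy_add_le` avoids proving continuity of the energy, at the
    -- price of the extra factor 2 in the constant.
    have hle : ∀ s : Finset ℤ, T * m ^ 2 / 3 * ‖∑ k ∈ s, modeBasis.repr φ k • mode k‖ ^ 2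
        ≤ 2 * energy C b T φ
          + 2 * (T * ‖C‖ ^ 2 * ‖(∑ k ∈ s, modeBasis.repr φ k • mode k) - φ‖ ^ 2) := by
      intro s
      have h1 := energy_add_le C b hT.le φ ((∑ k ∈ s, modeBasis.repr φ k • mode k) - φ)
      rw [add_sub_cancel] at h1
      have h2 := energy_le C b hT.le ((∑ k ∈ s, modeBasis.repr φ k • mode k) - φ)
      linarith [hfin s]
    have hl : Tendsto (fun s : Finset ℤ =>
        T * m ^ 2 / 3 * ‖∑ k ∈ s, modeBasis.repr φ k • mode k‖ ^ 2) atTop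
        (𝓝 (T * m ^ 2 / 3 * ‖φ‖ ^ 2)) :=
      ((Tendsto.norm hsum).pow 2).const_mul _
    have hr : Tendsto (fun s : Finset ℤ => 2 * energy C b T φ
          + 2 * (T * ‖C‖ ^ 2 * ‖(∑ k ∈ s, modeBasis.repr φ k • mode k) - φ‖ ^ 2)) atTop
        (𝓝 (2 * energy C b T φ + 2 * (T * ‖C‖ ^ 2 * ‖φ - φ‖ ^ 2))) :=
      (((((Tendsto.sub_const hsum φ).norm).pow 2).const_mul _).const_mul _).const_add _
    have := le_of_tendsto_of_tendsto' hl hr hle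
    rw [sub_self, norm_zero] at this
    linarith

/-! ### Unique continuation by filtering frequencies. -/

/-- Two distinct frequencies have equal phases only at times `2πn / (b k - b l)`; these are
countably many, so their complement is dense. -/
theorem exists_small_separating_time (b : ℤ → ℝ) {ε : ℝ} (hε : 0 < ε) :
    ∃ s ∈ Set.Ioo 0 ε, ∀ k l : ℤ, b k ≠ b l →
      Complex.exp (Complex.I * b k * s) ≠ Complex.exp (Complex.I * b l * s) := by
  have hc : (Set.range fun p : ℤ × ℤ × ℤ =>
      p.2.2 * (2 * π) / (b p.1 - b p.2.1)).Countable := Set.countable_range _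
  obtain ⟨s, hs, hs'⟩ := (hc.dense_compl ℝ).exists_mem_open isOpen_Ioo
    (Set.nonempty_Ioo.2 hε)
  refine ⟨s, hs', fun k l hkl he => hs ?_⟩
  obtain ⟨n, hn⟩ := Complex.exp_eq_exp_iff_exists_int.1 he
  refine ⟨(k, l, n), ?_⟩
  have h1 : (b k : ℂ) * s = b l * s + n * (2 * π) := by
    apply mul_left_cancel₀ Complex.I_ne_zero
    linear_combination hn
  have h2 : b k * s = b l * s + n * (2 * π) := by exact_mod_cast h1
  simp only
  rw [div_eq_iff (sub_ne_zero.2 hkl)]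
  linarith

/-- Difference operators in time remove frequencies from an unobserved state. -/
theorem exists_filtered_unobserved (s : ℝ) (hs : 0 ≤ s) {T : ℝ} {φ : L2}
    (h : ∀ t ∈ Set.Icc 0 T, C (unitaryGroup b t φ) = 0) (F : Finset ℝ) :
    ∃ ψ : L2, (∀ t ∈ Set.Icc 0 (T - F.card * s), C (unitaryGroup b t ψ) = 0) ∧
      ∀ k, modeBasis.repr ψ k = (∏ w ∈ F, (Complex.exp (Complex.I * b k * s)
        - Complex.exp (Complex.I * w * s))) * modeBasis.repr φ k := by
  induction F using Finset.induction_on with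
  | empty => exact ⟨φ, by simpa using h, by simp⟩
  | insert w F hw ih =>
    obtain ⟨ψ, hψ, hk⟩ := ih
    -- This multiplies mode `k` by the new factor and shortens the unobserved window by `s`.
    refine ⟨unitaryGroup b s ψ - Complex.exp (Complex.I * w * s) • ψ, ?_, fun k => ?_⟩
    · intro t ht
      rw [Finset.card_insert_of_notMem hw] at ht
      push_cast at ht
      have h1 := hψ (t + s) ⟨by linarith [ht.1], by linarith [ht.2]⟩
      have h2 := hψ t ⟨ht.1, by linarith [ht.2]⟩
      rw [map_sub, map_sub, map_smul, map_smul, h2, unitaryGroup_unitaryGroup, h1]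
      simp
    · rw [map_sub, map_smul, lp.coeFn_sub, Pi.sub_apply, lp.coeFn_smul, Pi.smul_apply,
        repr_unitaryGroup, Finset.prod_insert hw, hk, smul_eq_mul]
      ring

/-- Unique continuation. -/
theorem eq_zero_of_unobserved (hb : SpectralGap b) {m : ℝ} (hm : 0 < m)
    (hmC : ∀ᶠ k : ℤ in cofinite, m ≤ ‖C (mode k)‖)
    (hC : ∀ (s : Finset ℤ) (c : ℤ → ℂ), 0 ∉ s → C (∑ k ∈ s, c k • mode k) = 0 →
      ∀ k ∈ s, c k = 0)
    {T : ℝ} (hT : 0 < T) {φ : L2} (hφ : modeBasis.repr φ 0 = 0)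
    (h : ∀ t ∈ Set.Icc 0 T, C (unitaryGroup b t φ) = 0) : φ = 0 := by
  obtain ⟨N, c, hc, hinj, hN⟩ := high_frequency C b hb hm hmC (half_pos hT)
  set low : Finset ℤ := Finset.Ioo (-(N : ℤ)) N with hlow
  have mem_low : ∀ k : ℤ, k ∈ low ↔ |k| < N := fun k => by
    rw [hlow, Finset.mem_Ioo, abs_lt]
  -- Frequencies are collected as values, not indices: distinct low modes may share a frequency.
  set F : Finset ℝ := low.image b with hF
  -- With this bound on `s`, all the filters together use at most half of the time interval.
  obtain ⟨s, hs, hsep⟩ := exists_small_separating_time b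
    (ε := T / 2 / (F.card + 1)) (by positivity)
  have hFs : ∀ F' ⊆ F, T / 2 ≤ T - F'.card * s := by
    intro F' hF'
    have h1 : (F'.card : ℝ) ≤ F.card := by exact_mod_cast Finset.card_le_card hF'
    have h2 := (lt_div_iff₀ (by positivity)).1 hs.2
    nlinarith [hs.1]
  have hfilter : ∀ F' ⊆ F, ∃ ψ : L2, (∀ t ∈ Set.Icc 0 (T / 2), C (unitaryGroup b t ψ) = 0) ∧
      ∀ k, modeBasis.repr ψ k = (∏ w ∈ F', (Complex.exp (Complex.I * b k * s)
        - Complex.exp (Complex.I * w * s))) * modeBasis.repr φ k := by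
    intro F' hF'
    obtain ⟨ψ, h1, h2⟩ := exists_filtered_unobserved C b s hs.1.le h F'
    exact ⟨ψ, fun t ht => h1 t ⟨ht.1, ht.2.trans (hFs F' hF')⟩, h2⟩
  have hprod_zero : ∀ F' : Finset ℝ, ∀ k, b k ∈ F' →
      ∏ w ∈ F', (Complex.exp (Complex.I * b k * s) - Complex.exp (Complex.I * w * s)) = 0 :=
    fun F' k hk => Finset.prod_eq_zero hk (sub_self _)
  have hprod_ne : ∀ F' ⊆ F, ∀ k, b k ∉ F' →
      ∏ w ∈ F', (Complex.exp (Complex.I * b k * s) - Complex.exp (Complex.I * w * s)) ≠ 0 := by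
    intro F' hF' k hk
    refine Finset.prod_ne_zero_iff.2 fun w hw => sub_ne_zero.2 ?_
    obtain ⟨l, _, rfl⟩ := Finset.mem_image.1 (hF' hw)
    exact hsep k l fun he => hk (he ▸ hw)
  -- Filtering out every low frequency leaves a purely high state, which is zero by
  -- `high_frequency`. The filter factors do not vanish at high modes, so `φ` itself has no high
  -- modes.
  have hhigh : ∀ k, k ∉ low → modeBasis.repr φ k = 0 := by
    obtain ⟨ψ, h1, h2⟩ := hfilter F subset_rfl
    have hE : energy C b (T / 2) ψ = 0 := by
      refine (intervalIntegral.integral_congr (g := fun _ => (0 : ℝ)) fun t ht => ?_).trans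
        intervalIntegral.integral_zero
      rw [Set.uIcc_of_le (by positivity)] at ht
      simp [h1 t ht]
    have h3 := hN ψ fun k hk => by
      rw [h2, hprod_zero F k (Finset.mem_image_of_mem b ((mem_low k).2 hk)), zero_mul]
    have hψ : ψ = 0 := by
      rw [hE] at h3
      have : ‖ψ‖ ^ 2 ≤ 0 := nonpos_of_mul_nonpos_right h3 hc
      exact norm_eq_zero.1 (pow_eq_zero_iff two_ne_zero |>.1 (le_antisymm this (by positivity)))
    intro k hk
    have h4 := h2 k
    rw [hψ, map_zero] at h4
    refine (mul_eq_zero.1 h4.symm).resolve_left (hprod_ne F subset_rfl k fun hmem => ?_)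
    obtain ⟨l, hl, hlk⟩ := Finset.mem_image.1 hmem
    have := hinj k l (not_lt.1 fun hlt => hk ((mem_low k).2 hlt)) hlk.symm
    exact hk (this ▸ hl)
  apply L2_ext
  intro k₀
  rw [map_zero]
  change _ = (0 : ℂ)
  by_cases hk₀ : k₀ ∈ low
  swap
  · exact hhigh k₀ hk₀
  by_cases hz : k₀ = 0
  · rw [hz, hφ]
  -- Only modes sharing the frequency of `k₀` survive. They form a trigonometric polynomial, to
  -- which `hC` applies at time zero.
  obtain ⟨ψ, h1, h2⟩ := hfilter (F.erase (b k₀)) (Finset.erase_subset _ _)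
  have hψ : ψ = ∑ k ∈ low.erase 0, modeBasis.repr ψ k • mode k := by
    apply L2_ext
    intro k
    rw [repr_sum_mode]
    split_ifs with hk
    · rfl
    · rw [Finset.mem_erase, not_and_or, not_not] at hk
      rw [h2]
      rcases hk with rfl | hk
      · rw [hφ, mul_zero]
      · rw [hhigh k hk, mul_zero]
  have h3 : C ψ = 0 := by
    have := h1 0 ⟨le_rfl, by positivity⟩
    rwa [unitaryGroup_zero] at this
  rw [hψ] at h3
  have h4 := hC _ _ (Finset.notMem_erase 0 low) h3 k₀ (Finset.mem_erase.2 ⟨hz, hk₀⟩)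
  rw [h2] at h4
  exact (mul_eq_zero.1 h4).resolve_left
    (hprod_ne _ (Finset.erase_subset _ _) k₀ (Finset.notMem_erase _ _))

/-- The energy controls the norm on states without zero mode. -/
theorem observability (hb : SpectralGap b) {m : ℝ} (hm : 0 < m)
    (hmC : ∀ᶠ k : ℤ in cofinite, m ≤ ‖C (mode k)‖)
    (hC : ∀ (s : Finset ℤ) (c : ℤ → ℂ), 0 ∉ s → C (∑ k ∈ s, c k • mode k) = 0 →
      ∀ k ∈ s, c k = 0)
    {T : ℝ} (hT : 0 < T) :
    ∃ δ : ℝ, 0 < δ ∧ ∀ φ : L2, modeBasis.repr φ 0 = 0 →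
      δ ^ 2 * ‖φ‖ ^ 2 ≤ energy C b T φ := by
  obtain ⟨N, c, hc, -, hN⟩ := high_frequency C b hb hm hmC hT
  set low : Finset ℤ := Finset.Ioo (-(N : ℤ)) N with hlow
  have mem_low : ∀ k : ℤ, k ∈ low ↔ |k| < N := fun k => by
    rw [hlow, Finset.mem_Ioo, abs_lt]
  by_contra hcon
  push Not at hcon
  -- Failure at `δ = 1 / (n + 1)`, normalized.
  have hseq : ∀ n : ℕ, ∃ φ : L2, modeBasis.repr φ 0 = 0 ∧ ‖φ‖ = 1 ∧
      energy C b T φ ≤ (1 / ((n : ℝ) + 1)) ^ 2 := by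
    intro n
    obtain ⟨φ, h0, h1⟩ := hcon (1 / ((n : ℝ) + 1)) (by positivity)
    have hne : φ ≠ 0 := by
      rintro rfl
      have := energy_nonneg C b hT.le (0 : L2)
      rw [norm_zero] at h1
      linarith
    have hn : 0 < ‖φ‖ := norm_pos_iff.2 hne
    refine ⟨((‖φ‖⁻¹ : ℝ) : ℂ) • φ, ?_, ?_, ?_⟩
    · rw [map_smul, lp.coeFn_smul, Pi.smul_apply, h0, smul_zero]
    · rw [norm_smul, Complex.norm_real, norm_inv, norm_norm, inv_mul_cancel₀ hn.ne']
    · have : energy C b T (((‖φ‖⁻¹ : ℝ) : ℂ) • φ) = (‖φ‖ ^ 2)⁻¹ * energy C b T φ := by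
        unfold energy
        rw [← intervalIntegral.integral_const_mul]
        congr 1
        ext t
        rw [map_smul, map_smul, norm_smul, Complex.norm_real, norm_inv, norm_norm, mul_pow,
          inv_pow]
      rw [this, inv_mul_le_iff₀ (by positivity), mul_comm]
      exact h1.le
  choose φ hφ0 hφ1 hφE using hseq
  let x : ℕ → (low → ℂ) := fun n k => modeBasis.repr (φ n) k
  have hx : ∀ n, x n ∈ Metric.closedBall (0 : low → ℂ) 1 := by
    intro n
    rw [mem_closedBall_zero_iff, pi_norm_le_iff_of_nonneg zero_le_one]
    intro k
    refine (lp.norm_apply_le_norm two_ne_zero (modeBasis.repr (φ n)) k).trans ?_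
    rw [LinearIsometryEquiv.norm_map, hφ1]
  obtain ⟨y, -, f, hf, hy⟩ := tendsto_subseq_of_bounded Metric.isBounded_closedBall hx
  let P : L2 → L2 := fun ψ => ∑ k ∈ low, modeBasis.repr ψ k • mode k
  have hP : Tendsto (fun n => P (φ (f n))) atTop (𝓝 (∑ k : low, y k • mode k)) := by
    have h1 : ∀ n, P (φ (f n)) = ∑ k : low, x (f n) k • mode k := fun n =>
      (Finset.sum_coe_sort low fun k => modeBasis.repr (φ (f n)) k • mode k).symm
    simp only [h1]
    exact tendsto_finsetSum _ fun k _ => ((tendsto_pi_nhds.1 hy) k).smul_const _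
  set K : ℝ := T * ‖C‖ ^ 2
  have hK : 0 ≤ K := by positivity
  have hPsub : ∀ ψ χ, P (ψ - χ) = P ψ - P χ := by
    intro ψ χ
    simp only [P, map_sub, lp.coeFn_sub, Pi.sub_apply, sub_smul, Finset.sum_sub_distrib]
  -- Applied to differences of the sequence, this turns small energies and convergent low parts into
  -- a Cauchy high part, so the convergence is strong and the limit keeps norm one.
  have hcontrol : ∀ ψ : L2, c * ‖ψ - P ψ‖ ^ 2 ≤ 2 * energy C b T ψ + 2 * (K * ‖P ψ‖ ^ 2) := by
    intro ψ
    have h1 := hN (ψ - P ψ) fun k hk => by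
      rw [map_sub, lp.coeFn_sub, Pi.sub_apply, repr_sum_mode, if_pos ((mem_low k).2 hk), sub_self]
    have h2 := energy_add_le C b hT.le ψ (-P ψ)
    have h3 := energy_le C b hT.le (-P ψ)
    rw [norm_neg] at h3
    rw [← sub_eq_add_neg] at h2
    linarith
  have henergy_neg : ∀ ψ, energy C b T (-ψ) = energy C b T ψ := by
    intro ψ
    simp only [energy, map_neg, norm_neg]
  have hE0 : Tendsto (fun n => energy C b T (φ (f n))) atTop (𝓝 0) := by
    have h1 : Tendsto (fun n : ℕ => (1 / ((n : ℝ) + 1)) ^ 2) atTop (𝓝 0) := by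
      simpa using (tendsto_one_div_add_atTop_nhds_zero_nat (𝕜 := ℝ)).pow 2
    exact squeeze_zero (fun n => energy_nonneg C b hT.le _) (fun n => hφE (f n))
      (h1.comp hf.tendsto_atTop)
  have hcauchy : CauchySeq fun n => φ (f n) - P (φ (f n)) := by
    rw [cauchySeq_iff_tendsto_dist_atTop_0]
    have hbound : ∀ p : ℕ × ℕ,
        dist (φ (f p.1) - P (φ (f p.1))) (φ (f p.2) - P (φ (f p.2)))
          ≤ Real.sqrt (c⁻¹ * (2 * (2 * energy C b T (φ (f p.1)) + 2 * energy C b T (φ (f p.2)))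
            + 2 * (K * dist (P (φ (f p.1))) (P (φ (f p.2))) ^ 2))) := by
      intro p
      apply Real.le_sqrt_of_sq_le
      rw [← div_eq_inv_mul, le_div_iff₀ hc, mul_comm, dist_eq_norm, dist_eq_norm]
      have h1 := hcontrol (φ (f p.1) - φ (f p.2))
      have h2 := energy_add_le C b hT.le (φ (f p.1)) (-φ (f p.2))
      rw [henergy_neg, ← sub_eq_add_neg] at h2
      rw [hPsub] at h1
      have h3 : φ (f p.1) - P (φ (f p.1)) - (φ (f p.2) - P (φ (f p.2)))
          = φ (f p.1) - φ (f p.2) - (P (φ (f p.1)) - P (φ (f p.2))) := by abel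
      rw [h3]
      linarith
    refine squeeze_zero (fun _ => dist_nonneg) hbound ?_
    have hA : Tendsto (fun p : ℕ × ℕ => energy C b T (φ (f p.1))) atTop (𝓝 0) := by
      rw [← prod_atTop_atTop_eq]
      exact hE0.comp tendsto_fst
    have hB : Tendsto (fun p : ℕ × ℕ => energy C b T (φ (f p.2))) atTop (𝓝 0) := by
      rw [← prod_atTop_atTop_eq]
      exact hE0.comp tendsto_snd
    have hD := cauchySeq_iff_tendsto_dist_atTop_0.1 hP.cauchySeq
    have := (((((hA.const_mul 2).add (hB.const_mul 2)).const_mul 2).add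
      (((hD.pow 2).const_mul K).const_mul 2)).const_mul c⁻¹).sqrt
    simpa using this
  obtain ⟨q, hq⟩ := cauchySeq_tendsto_of_complete hcauchy
  have hlim : Tendsto (fun n => φ (f n)) atTop (𝓝 (q + ∑ k : low, y k • mode k)) := by
    simpa using hq.add hP
  set Φ : L2 := q + ∑ k : low, y k • mode k
  have hΦ1 : ‖Φ‖ = 1 := by
    refine tendsto_nhds_unique hlim.norm ?_
    simp only [hφ1]
    exact tendsto_const_nhds
  have hΦ0 : modeBasis.repr Φ 0 = 0 := by
    have hcont : Continuous fun ψ : L2 => modeBasis.repr ψ 0 := by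
      simp only [HilbertBasis.repr_apply_apply]
      fun_prop
    refine tendsto_nhds_unique ((hcont.tendsto Φ).comp hlim) ?_
    simp only [Function.comp_def, hφ0]
    exact tendsto_const_nhds
  have hΦE : energy C b T Φ ≤ 0 := by
    have hle : ∀ n, energy C b T Φ ≤ 2 * energy C b T (φ (f n))
        + 2 * (K * ‖Φ - φ (f n)‖ ^ 2) := by
      intro n
      have h1 := energy_add_le C b hT.le (φ (f n)) (Φ - φ (f n))
      rw [add_sub_cancel] at h1
      linarith [energy_le C b hT.le (Φ - φ (f n))]
    have hr := (hE0.const_mul 2).add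
      ((((((hlim.const_sub Φ).norm).pow 2)).const_mul K).const_mul 2)
    refine (ge_of_tendsto' hr hle).trans (le_of_eq ?_)
    simp
  have := eq_zero_of_unobserved C b hb hm hmC hC hT hΦ0
    fun t ht => observation_eq_zero_of_energy C b hT hΦE ht
  rw [this, norm_zero] at hΦ1
  exact zero_ne_one hΦ1

end Observability

/-! ### Spectral gap of the dispersion relation. -/

theorem SpectralGap.neg {b : ℤ → ℝ} (hb : SpectralGap b) : SpectralGap fun k => -b k := by
  intro γ
  obtain ⟨N, hN⟩ := hb γ
  refine ⟨N, fun k l hk => ?_⟩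
  rw [neg_sub_neg, abs_sub_comm]
  exact hN k l hk

theorem abs_mul_abs_sub_le (x y : ℝ) : abs (x * |x| - y * |y|) ≤ |x - y| * (|x| + |y|) := by
  have h : x * |x| - y * |y| = (x - y) * |x| + y * (|x| - |y|) := by ring
  rw [h]
  refine (abs_add_le _ _).trans ?_
  rw [abs_mul, abs_mul, abs_abs]
  nlinarith [abs_abs_sub_abs_le x y, abs_nonneg y]

/-- Factor out `x - y` and use `x² + xy + y² ≥ (x² + y²) / 2`. The Hilbert transform term costs `α
(|x| + |y|)`, and `y² / 2 - α |y| ≥ -α² / 2` removes `y`, so largeness of `x` alone suffices. -/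
theorem dispersion_gap {α : ℝ} (hα : 0 ≤ α) (μ x y : ℝ) :
    |x - y| * (x ^ 2 / 2 - α * |x| - α ^ 2 / 2 - 2 * |μ|)
      ≤ abs ((-x ^ 3 - 2 * μ * x + α * x * |x|) - (-y ^ 3 - 2 * μ * y + α * y * |y|)) := by
  have h1 := abs_mul_abs_sub_le x y
  have h2 : |(x - y) * (x ^ 2 + x * y + y ^ 2 + 2 * μ)|
      ≤ abs ((-x ^ 3 - 2 * μ * x + α * x * |x|) - (-y ^ 3 - 2 * μ * y + α * y * |y|))
        + α * abs (x * |x| - y * |y|) := by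
    rw [← abs_of_nonneg hα, ← abs_mul, abs_of_nonneg hα, ← abs_neg ((x - y) * _)]
    refine le_trans (le_of_eq ?_) (abs_sub _ _)
    congr 1
    ring
  have h3 : (x ^ 2 + y ^ 2) / 2 - 2 * |μ| ≤ |x ^ 2 + x * y + y ^ 2 + 2 * μ| := by
    refine le_trans ?_ (le_abs_self _)
    nlinarith [neg_abs_le μ, sq_nonneg (x + y)]
  have h4 : x ^ 2 / 2 - α * |x| - α ^ 2 / 2 - 2 * |μ|
      ≤ |x ^ 2 + x * y + y ^ 2 + 2 * μ| - α * (|x| + |y|) := by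
    nlinarith [sq_nonneg (|y| - α), sq_abs y]
  rw [abs_mul] at h2
  have h5 := mul_le_mul_of_nonneg_left h4 (abs_nonneg (x - y))
  have h6 := mul_le_mul_of_nonneg_left h1 hα
  nlinarith

theorem spectralGap_dispersion {α : ℝ} (hα : 0 ≤ α) (μ : ℝ) :
    SpectralGap fun k => -(k : ℝ) ^ 3 - 2 * μ * k + α * k * |(k : ℝ)| := by
  intro γ
  set M : ℝ := |γ| + α ^ 2 / 2 + 2 * |μ| with hM
  have hM0 : 0 ≤ M := by positivity
  -- For `|k| ≥ 2α + 2M + 1`, the product `|k| (|k| / 2 - α)` is at least `M`.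
  obtain ⟨N, hN⟩ := exists_nat_ge (2 * α + 2 * M + 1)
  refine ⟨N, fun k l hk => ?_⟩
  have hk' : (2 * α + 2 * M + 1 : ℝ) ≤ |(k : ℝ)| := hN.trans (by exact_mod_cast hk)
  refine le_trans ?_ (dispersion_gap hα μ k l)
  push_cast
  rw [mul_comm]
  refine mul_le_mul_of_nonneg_left ?_ (abs_nonneg _)
  have : γ ≤ |γ| := le_abs_self γ
  rw [← sq_abs (k : ℝ)]
  nlinarith

/-! ### The control operator on modes and on trigonometric polynomials. -/

theorem repr_zero_of_integral_eq_zero {φ : L2} (h : ∫ x, φ x = 0) :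
    modeBasis.repr φ 0 = 0 := by
  rw [modeBasis_repr, fourierCoeff, AddCircle.integral_haarAddCircle]
  simp [h]

theorem coeFn_mode (k : ℤ) :
    mode k =ᵐ[volume] fun x => ((Real.sqrt (2 * π))⁻¹ : ℂ) * fourier k x := by
  filter_upwards [ContinuousMap.coeFn_toLp (p := 2) (𝕜 := ℂ) (volume : Measure Torus)
    (((Real.sqrt (2 * π))⁻¹ : ℂ) • fourier k)] with x hx
  rw [mode, hx]
  rfl

theorem norm_mulOp_mode (g : C(Torus, ℝ)) (k : ℤ) :
    ‖mulOp g (mode k)‖ = (Real.sqrt (2 * π))⁻¹ *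
      ‖ContinuousMap.toLp (E := ℂ) 2 (volume : Measure Torus) ℂ (toComplex g)‖ := by
  have hs : 0 ≤ (Real.sqrt (2 * π))⁻¹ := by positivity
  have h : ‖(((Real.sqrt (2 * π))⁻¹ : ℝ) : ℂ) •
      ContinuousMap.toLp (E := ℂ) 2 (volume : Measure Torus) ℂ (toComplex g)‖
      = (Real.sqrt (2 * π))⁻¹ *
        ‖ContinuousMap.toLp (E := ℂ) 2 (volume : Measure Torus) ℂ (toComplex g)‖ := by
    rw [norm_smul, Complex.norm_real, Real.norm_of_nonneg hs]
  rw [← h, Lp.norm_def, Lp.norm_def]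
  congr 1
  apply eLpNorm_congr_norm_ae
  filter_upwards [coeFn_mulOp g (mode k), coeFn_mode k, ContinuousMap.coeFn_toLp (p := 2)
    (𝕜 := ℂ) (volume : Measure Torus) (toComplex g), Lp.coeFn_smul
    (((Real.sqrt (2 * π))⁻¹ : ℝ) : ℂ)
    (ContinuousMap.toLp (E := ℂ) 2 (volume : Measure Torus) ℂ (toComplex g))] with x h1 h2 h3 h4
  have hk : ‖fourier k x‖ = 1 := by
    rw [fourier_apply]
    exact Circle.norm_coe _
  rw [h1, h2, h4, Pi.smul_apply, h3, norm_mul, norm_mul, hk, norm_smul, mul_one, mul_comm,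
    Complex.ofReal_inv]
  rfl

/-- Riemann–Lebesgue, from Bessel's inequality. -/
theorem tendsto_inner_mode (γ : L2) : Tendsto (fun k => ⟪γ, mode k⟫_ℂ) cofinite (𝓝 0) := by
  have h := orthonormal_mode.inner_products_summable γ
  have h2 := h.tendsto_cofinite_zero
  rw [tendsto_zero_iff_norm_tendsto_zero]
  have h3 := h2.sqrt
  rw [Real.sqrt_zero] at h3
  refine h3.congr fun k => ?_
  rw [Real.sqrt_sq (norm_nonneg _), norm_inner_symm]

/-- Modes have constant modulus, so the multiplication part has a norm independent of `k`, nonzero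
because `g` has integral one; the rank-one part tends to zero. -/
theorem G_mode_bounded_below (g : C(Torus, ℝ)) (hg : IsControlProfile g) :
    ∃ m > 0, ∀ᶠ k : ℤ in cofinite, m ≤ ‖G g (mode k)‖ := by
  set γ := ContinuousMap.toLp (E := ℂ) 2 (volume : Measure Torus) ℂ (toComplex g) with hγ
  have hγ0 : 0 < ‖γ‖ := by
    rw [norm_pos_iff]
    intro h0
    have h1 : ∀ᵐ x : Torus, g x = 0 := by
      filter_upwards [ContinuousMap.coeFn_toLp (p := 2) (𝕜 := ℂ) (volume : Measure Torus)
        (toComplex g), Lp.coeFn_zero ℂ 2 (volume : Measure Torus)] with x hx hx0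
      rw [← hγ, h0, hx0] at hx
      exact Complex.ofReal_eq_zero.1 hx.symm
    have h2 := hg.integral_eq_one
    rw [integral_congr_ae h1, integral_zero] at h2
    exact zero_ne_one h2
  set r : ℝ := (Real.sqrt (2 * π))⁻¹ with hr
  have hr0 : 0 < r := by
    have := Real.two_pi_pos
    positivity
  refine ⟨r * ‖γ‖ / 2, by positivity, ?_⟩
  have ht := (tendsto_zero_iff_norm_tendsto_zero.1 (tendsto_inner_mode γ)).eventually
    (gt_mem_nhds (half_pos hr0))
  filter_upwards [ht] with k hk
  rw [G_eq]
  refine le_trans ?_ (norm_sub_norm_le _ _)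
  rw [norm_mulOp_mode, norm_smul]
  nlinarith

/-- The identity theorem for the real-analytic lift to `ℝ`. -/
theorem trigonometric_eq_const_of_Ioo (s : Finset ℤ) (c : ℤ → ℂ) (z : ℂ) {u v : ℝ} (huv : u < v)
    (h : ∀ x ∈ Set.Ioo u v, ∑ k ∈ s, c k * fourier k (x : Torus) = z) (x : Torus) :
    ∑ k ∈ s, c k * fourier k x = z := by
  have hf : ∀ (k : ℤ) (y : ℝ), fourier k (y : Torus) = Complex.exp (Complex.I * k * y) := by
    intro k y
    rw [fourier_coe_apply]
    congr 1
    push_cast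
    have : (π : ℂ) ≠ 0 := by exact_mod_cast Real.pi_ne_zero
    field_simp
  have han : AnalyticOnNhd ℝ
      (fun y : ℝ => ∑ k ∈ s, c k * Complex.exp (Complex.I * k * y)) Set.univ := by
    intro y _
    have hid : AnalyticAt ℝ (fun y : ℝ => (y : ℂ)) y := Complex.ofRealCLM.analyticAt y
    refine Finset.analyticAt_fun_sum _ fun k _ => ?_
    refine analyticAt_const.mul ?_
    exact (analyticAt_cexp.restrictScalars (𝕜 := ℝ)).comp (analyticAt_const.mul hid)
  obtain ⟨w, hw⟩ := Set.nonempty_Ioo.2 huv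
  have heq := han.eq_of_eventuallyEq (g := fun _ => z) analyticOnNhd_const (z₀ := w) (by
    filter_upwards [isOpen_Ioo.mem_nhds hw] with y hy
    rw [← h y hy]
    simp only [hf])
  induction x using QuotientAddGroup.induction_on with
  | H y =>
    have := congrFun heq y
    simp only [hf]
    exact this

theorem G_injective_trigonometric (g : C(Torus, ℝ)) (hg : IsControlProfile g)
    (s : Finset ℤ) (c : ℤ → ℂ) (hs : 0 ∉ s) (h : G g (∑ k ∈ s, c k • mode k) = 0) :
    ∀ k ∈ s, c k = 0 := by
  set r : ℂ := ((Real.sqrt (2 * π))⁻¹ : ℂ) with hr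
  have hr0 : r ≠ 0 := by
    have := Real.two_pi_pos
    rw [hr, ← Complex.ofReal_inv]
    exact_mod_cast (by positivity : (Real.sqrt (2 * π))⁻¹ ≠ 0)
  set p : C(Torus, ℂ) := ∑ k ∈ s, (c k * r) • fourier k with hp
  have hp_apply : ∀ x, p x = ∑ k ∈ s, c k * r * fourier k x := by
    intro x
    simp [hp, ContinuousMap.sum_apply]
  have hpL : ContinuousMap.toLp (E := ℂ) 2 (volume : Measure Torus) ℂ p
      = ∑ k ∈ s, c k • mode k := by
    rw [hp, map_sum]
    refine Finset.sum_congr rfl fun k _ => ?_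
    rw [mode, ← map_smul, smul_smul]
  rw [← hpL] at h
  set z : ℂ := ∫ y : Torus, (g y : ℂ) *
    (ContinuousMap.toLp (E := ℂ) 2 (volume : Measure Torus) ℂ p) y with hz
  have hae : (fun x => (g x : ℂ) * (p x - z)) =ᵐ[volume] fun _ : Torus => (0 : ℂ) := by
    filter_upwards [coeFn_G g (ContinuousMap.toLp (E := ℂ) 2 (volume : Measure Torus) ℂ p),
      ContinuousMap.coeFn_toLp (p := 2) (𝕜 := ℂ) (volume : Measure Torus) p,
      Lp.coeFn_zero ℂ 2 (volume : Measure Torus)] with x h1 h2 h3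
    rw [h, h3, ← hz, h2] at h1
    exact h1.symm
  -- Both sides are continuous, so almost everywhere becomes everywhere and evaluation at points of
  -- the arc is legitimate.
  have hall : (fun x => (g x : ℂ) * (p x - z)) = fun _ : Torus => (0 : ℂ) :=
    (Continuous.ae_eq_iff_eq volume (by fun_prop) continuous_const).1 hae
  obtain ⟨u, v, huv, harc⟩ := hg.arc
  have hconst := trigonometric_eq_const_of_Ioo s (fun k => c k * r) z huv fun x hx => by
    have hgx : (x : Torus) ∈ {x : Torus | 0 < g x} := harc ▸ Set.mem_image_of_mem _ hx
    have hx0 := congrFun hall (x : Torus)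
    rw [← hp_apply]
    refine sub_eq_zero.1 ((mul_eq_zero.1 hx0).resolve_left ?_)
    exact_mod_cast hgx.ne'
  -- A constant is a multiple of `mode 0`, so its coefficients at the nonzero indices of `s` vanish.
  have hpz : p = (z / r) • (r • fourier 0) := by
    ext x
    rw [hp_apply, hconst x]
    simp [hr0]
  intro k hk
  have h1 := repr_sum_mode s c k
  rw [if_pos hk, ← hpL, hpz, map_smul, ← mode, map_smul, lp.coeFn_smul, Pi.smul_apply, repr_mode,
    if_neg (fun h0 : k = 0 => hs (h0 ▸ hk)), smul_zero] at h1
  exact h1.symm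

/-- The control operator observes every dispersive group with a spectral gap. -/
theorem observability_G (g : C(Torus, ℝ)) (hg : IsControlProfile g) {b : ℤ → ℝ}
    (hb : SpectralGap b) {T : ℝ} (hT : 0 < T) :
    ∃ δ : ℝ, 0 < δ ∧ ∀ φ : L2, (∫ x, φ x) = 0 →
      δ ^ 2 * ‖φ‖ ^ 2 ≤ ∫ τ in (0 : ℝ)..T, ‖G g (unitaryGroup b (-τ) φ)‖ ^ 2 := by
  obtain ⟨m, hm, hmG⟩ := G_mode_bounded_below g hg
  obtain ⟨δ, hδ, h⟩ := observability (G g) _ hb.neg hm hmG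
    (G_injective_trigonometric g hg) hT
  refine ⟨δ, hδ, fun φ hφ => ?_⟩
  simp only [unitaryGroup_neg]
  exact h φ (repr_zero_of_integral_eq_zero hφ)

end Benjamin

end

theorem mainTheorem4 (α : ℝ) (hα : 0 < α)
    (g : C(Benjamin.Torus, ℝ)) (hg : Benjamin.IsControlProfile g)
    (T : ℝ) (hT : 0 < T) :
    (∃ δ : ℝ, 0 < δ ∧ ∀ φ : Benjamin.L2, (∫ x, φ x) = 0 →
      δ ^ 2 * ‖φ‖ ^ 2 ≤ ∫ τ in (0 : ℝ)..T, ‖Benjamin.G g (Benjamin.U α (-τ) φ)‖ ^ 2) ∧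
    (∀ μ : ℝ, ∃ δ : ℝ, 0 < δ ∧ ∀ φ : Benjamin.L2, (∫ x, φ x) = 0 →
      δ ^ 2 * ‖φ‖ ^ 2 ≤ ∫ τ in (0 : ℝ)..T,
        ‖(ContinuousLinearMap.adjoint (Benjamin.G g))
          ((ContinuousLinearMap.adjoint (Benjamin.Umu α μ τ)) φ)‖ ^ 2) := by
  constructor
  · refine Benjamin.observability_G g hg ?_ hT
    -- The symbol of `U` is that of `Umu` at `μ = 0`, because `sgn k * k = |k|`.
    have hfreq : (fun k : ℤ => (k : ℝ) ^ 2 * (α * (k.sign : ℝ) - k))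
        = fun k : ℤ => -(k : ℝ) ^ 3 - 2 * 0 * k + α * k * |(k : ℝ)| := by
      funext k
      have h : (k.sign : ℝ) * k = |(k : ℝ)| := by
        rw [← Int.cast_mul, Int.sign_mul_self_eq_abs, Int.cast_abs]
      rw [← h]
      ring
    rw [hfreq]
    exact Benjamin.spectralGap_dispersion hα.le 0
  · intro μ
    simp only [Benjamin.adjoint_G, Benjamin.Umu, Benjamin.adjoint_unitaryGroup]
    exact Benjamin.observability_G g hg (Benjamin.spectralGap_dispersion hα.le μ) hT
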